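/- **Definitions.** For $a>0$, $z>0$, $b\in\mathbb C$ let $$\Psi(a,b;z)=\frac1{\Gamma(a)}\int_0^\infty e^{-zt}t^{a-1}(1+t)^{b-a-1}\,dt$$ be Tricomi's confluent hypergeometric function. For real $a,\alpha,A,\varphi$ with $A\ge 0$, $\varphi>0$ and $s\in\mathbb C$ put $$\Xi(a,\alpha,A,\varphi)(s)=A^{\varphi+a+\alpha s-1}\,\Psi(\varphi,\varphi+a+\alpha s;A)\quad(A>0),\qquad \Xi(a,\alpha,0,\varphi)(s)=\frac{\Gamma(\varphi+a+\alpha s-1)}{\Gamma(\varphi)},$$ so that $\Xi(a,\alpha,0,1)(s)=\Gamma(a+\alpha s)$. The generalized Fox $H$ function is $$Y^{m,n}_{p,q}\left[\begin{matrix}(a_i,\alpha_i,A_i,\varphi_i)_{i=1}^{p}\\(b_j,\beta_j,B_j,\phi_j)_{j=1}^{q}\end{matrix}\,\middle|\,z\right]=\frac1{2\pi \mathrm i}\int_{c-\mathrm i\infty}^{c+\mathrm i\infty}M(s)\,z^{-s}\,ds,$$ $$M(s)=\frac{\prod_{j=1}^{m}\Xi(b_j,\beta_j,B_j,\phi_j)(s)\,\prod_{i=1}^{n}\Xi(1-a_i,-\alpha_i,A_i,\varphi_i)(s)}{\prod_{i=n+1}^{p}\Xi(a_i,\alpha_i,A_i,\varphi_i)(s)\,\prod_{j=m+1}^{q}\Xi(1-b_j,-\beta_j,B_j,\phi_j)(s)},$$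 where the line $\operatorname{Re}s=c$ is a Mellin–Barnes contour: all singularities of the factors $\Xi(b_j,\beta_j,B_j,\phi_j)$, $j\le m$, lie strictly to its left, and all singularities of the factors $\Xi(1-a_i,-\alpha_i,A_i,\varphi_i)$, $i\le n$, lie strictly to its right. **Statement.** Let $k\ge1$, let $\gamma_T>0$ and, for $1\le l\le k$, let $m_l,\Omega_l,R_l>0$. Let $\alpha_1,\dots,\alpha_k$ be independent random variables, $\alpha_l$ being Gamma distributed with shape $m_l$ and scale $\Omega_l/m_l$ (independent Nakagami-$m$ fading), and let $\gamma_l=\gamma_T\alpha_l$. Let $$\hat p_k=\Pr\Bigl(\sum_{l=1}^k\frac1{R_l}\log_2(1+\gamma_l)<1\Bigr)$$ be the outage probability of variable-rate HARQ after $k$ rounds. Then $$\hat p_k=Y^{k,1}_{1,k+1}\left[\begin{matrix}(1,1,0,1)\\\bigl(1,\tfrac1{R_1},\tfrac{m_1}{\gamma_T\Omega_1},m_1\bigr),\dots,\bigl(1,\tfrac1{R_k},\tfrac{m_k}{\gamma_T\Omega_k},m_k\bigr),(0,1,0,1)\end{matrix}\,\middle|\,2\prod_{l=1}^k\Bigl(\frac{m_l}{\gamma_T\Omega_l}\Bigr)^{1/R_l}\right].$$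 More precisely, vertical Mellin–Barnes contours exist for this $Y$ function, and for every such contour $M$ is absolutely integrable along it and the contour integral equals $\hat p_k$. -/

import Mathlib

open MeasureTheory ProbabilityTheory

noncomputable section

/-- Tricomi's confluent hypergeometric function `Ψ(a, b; z)` for `a > 0` and `z > 0` (`b` complex),
`Ψ(a, b; z) = (1 / Γ(a)) ∫_0^∞ e^{-z t} t^{a-1} (1+t)^{b-a-1} dt`. -/
def tricomiPsi (a : ℝ) (b : ℂ) (z : ℝ) : ℂ :=
  (Complex.Gamma (a : ℂ))⁻¹ *
    ∫ t in Set.Ioi (0 : ℝ),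
      (Real.exp (-z * t) : ℂ) * ((t ^ (a - 1) : ℝ) : ℂ) * ((1 + t : ℝ) : ℂ) ^ (b - (a : ℂ) - 1)

/-- A parameter quadruple `(a, α, A, φ)` of the generalized Fox H function. -/
structure FoxParam where
  a : ℝ
  α : ℝ
  A : ℝ
  φ : ℝ

/-- The quadruple `(1 - a, -α, A, φ)`. -/
def FoxParam.reflect (P : FoxParam) : FoxParam :=
  ⟨1 - P.a, -P.α, P.A, P.φ⟩

/-- The factor `Ξ(a, α, A, φ)(s) = A^{φ+a+αs-1} Ψ(φ, φ+a+αs; A)` for `A > 0`. For `A = 0` it is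
the (analytically continued) limit as `A → 0+`, namely `Γ(φ+a+αs-1) / Γ(φ)`; so
`Ξ(a, α, 0, 1)(s) = Γ(a + α s)`. -/
def foxXi (P : FoxParam) (s : ℂ) : ℂ :=
  if P.A = 0 then
    Complex.Gamma ((P.φ : ℂ) + P.a + P.α * s - 1) / Complex.Gamma (P.φ : ℂ)
  else
    (P.A : ℂ) ^ ((P.φ : ℂ) + P.a + P.α * s - 1) * tricomiPsi P.φ ((P.φ : ℂ) + P.a + P.α * s) P.A

/-- The Mellin-Barnes kernel of `Y^{m,n}_{p,q}` with upper parameters `U` and lower parameters `L`: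
`∏_{j ≤ m} Ξ(b_j, β_j, B_j, ϕ_j)(s) ∏_{i ≤ n} Ξ(1 - a_i, -α_i, A_i, φ_i)(s)` divided by
`∏_{i > n} Ξ(a_i, α_i, A_i, φ_i)(s) ∏_{j > m} Ξ(1 - b_j, -β_j, B_j, ϕ_j)(s)`. -/
def foxKernel (m n : ℕ) {p q : ℕ} (U : Fin p → FoxParam) (L : Fin q → FoxParam) (s : ℂ) : ℂ :=
  ((∏ j : Fin q with j.val < m, foxXi (L j) s) *
      ∏ i : Fin p with i.val < n, foxXi (U i).reflect s) /
    ((∏ i : Fin p with n ≤ i.val, foxXi (U i) s) *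
      ∏ j : Fin q with m ≤ j.val, foxXi (L j).reflect s)

/-- The vertical line `Re s = c` is a Mellin-Barnes contour for `Y^{m,n}_{p,q}`: all singularities
of the factors `Ξ(b_j, β_j, B_j, ϕ_j)`, `j ≤ m`, lie strictly to its left and all singularities
of the factors `Ξ(1 - a_i, -α_i, A_i, φ_i)`, `i ≤ n`, lie strictly to its right. -/
def IsFoxContour (m n : ℕ) {p q : ℕ} (U : Fin p → FoxParam) (L : Fin q → FoxParam) (c : ℝ) :
    Prop :=
  (∀ j : Fin q, j.val < m → ∀ s : ℂ, ¬ AnalyticAt ℂ (foxXi (L j)) s → s.re < c) ∧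
    (∀ i : Fin p, i.val < n → ∀ s : ℂ, ¬ AnalyticAt ℂ (foxXi (U i).reflect) s → c < s.re)

/-- The generalized Fox H function `Y^{m,n}_{p,q}[U; L | z]`, that is
`(1 / 2πi) ∫ foxKernel(s) z^{-s} ds` along the line `Re s = c`. -/
def foxY (m n : ℕ) {p q : ℕ} (U : Fin p → FoxParam) (L : Fin q → FoxParam) (c z : ℝ) : ℂ :=
  mellinInv c (foxKernel m n U L) z

/-- The upper parameter `(1, 1, 0, 1)`. -/
def vrUpper : Fin 1 → FoxParam :=
  fun _ => ⟨1, 1, 0, 1⟩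

/-- The lower parameters `(1, 1/R_l, m_l/(γ_T Ω_l), m_l)`, `l = 1, …, k`, followed by
`(0, 1, 0, 1)`. -/
def vrLower {k : ℕ} (γT : ℝ) (m Ω R : Fin k → ℝ) : Fin (k + 1) → FoxParam :=
  Fin.snoc (α := fun _ => FoxParam) (fun l => ⟨1, 1 / R l, m l / (γT * Ω l), m l⟩) ⟨0, 1, 0, 1⟩

/-- The outage probability after `k` rounds of variable-rate HARQ,
`Pr(∑_l (1/R_l) log₂(1 + γ_l) < 1)` with `γ_l = γ_T α_l`. -/
def vrOutageProb {S : Type*} [MeasurableSpace S] (μ : Measure S) {k : ℕ} (γT : ℝ)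
    (R : Fin k → ℝ) (α : Fin k → S → ℝ) : ℝ :=
  μ.real {ω | ∑ l, (1 / R l) * Real.logb 2 (1 + γT * α l ω) < 1}

end

/-!
Write `A_l = m_l / (γ_T Ω_l)` and `V = ∑_l (1/R_l) (log A_l + log (1 + γ_T α_l))`. Outage is the
event `exp V < z` with `z = 2 ∏_l A_l^{1/R_l}`, and the `Y` function is the inverse Mellin transform
of the distribution function of `exp V`.

Each factor `Ξ(1, 1/R_l, A_l, m_l)(s)` is the moment `E[(A_l (1 + γ_T α_l))^{s/R_l}]`, because the
integral defining Tricomi's function is an integral against a rescaled Gamma density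
(`foxXi_eq_complexMGF`). All exponential moments exist, so these factors are entire, and by
independence their product is `E[exp (s V)]`. The two remaining factors are `Γ(-s)` and
`1 / Γ(1-s)`; hence the contours are the lines `Re s = c` with `c < 0` (`isFoxContour_iff`), on
which the kernel is `-E[exp (s V)] / s` (`foxKernel_vr`). By Fubini this is the Mellin transform of
`y ↦ Pr(exp V < y)` (`mellin_measureReal_Iio_log`). Mellin inversion at `y = z` needs that `V` has
no atom at `log z`, which holds since one independent summand has no atoms, and that the kernel is
absolutely integrable along the contour.

For the latter, `1/s` alone is not enough. The missing decay comes from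
`exists_norm_tricomiIntegral_le_rpow`: along vertical lines `∫_0^∞ e^{-zt} t^{a-1} (1+t)^w dt` is
`O(|Im w|^{-δ})` for some `δ > 0`. The piece over `(0, ε]` is `O(ε^a)` by size, the piece over
`(ε, ∞)` is `O((ε^{a-1} + ε^{-1}) / |w|)` by one integration by parts, and `ε = |Im w|^{-1/2}` makes
both small.
-/

/-! ### Mellin transform and inversion of distribution functions -/

theorem integrable_prod_exp_lt {ν : Measure ℝ} [IsProbabilityMeasure ν] {s : ℂ} (hs : s.re < 0)
    (hν : Integrable (fun v => Real.exp (s.re * v)) ν) :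
    Integrable (Function.uncurry fun (y v : ℝ) =>
      Set.indicator {p : ℝ × ℝ | Real.exp p.2 < p.1} (fun p => (p.1 : ℂ) ^ (s - 1)) (y, v))
      ((volume.restrict (Set.Ioi 0)).prod ν) := by
  have hset : MeasurableSet {p : ℝ × ℝ | Real.exp p.2 < p.1} :=
    measurableSet_lt (by fun_prop) (by fun_prop)
  have hmeas : Measurable (Function.uncurry fun (y v : ℝ) =>
      Set.indicator {p : ℝ × ℝ | Real.exp p.2 < p.1} (fun p => (p.1 : ℂ) ^ (s - 1)) (y, v)) := by
    refine Measurable.indicator ?_ hset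
    fun_prop
  have key : ∀ v : ℝ, ∀ y : ℝ,
      Set.indicator {p : ℝ × ℝ | Real.exp p.2 < p.1} (fun p => (p.1 : ℂ) ^ (s - 1)) (y, v) =
        (Set.Ioi (Real.exp v)).indicator (fun y : ℝ => (y : ℂ) ^ (s - 1)) y := by
    intro v y
    simp only [Set.indicator, Set.mem_ofPred_eq, Set.mem_Ioi]
  have hsub : ∀ v : ℝ, Set.Ioi (Real.exp v) ∩ Set.Ioi 0 = Set.Ioi (Real.exp v) := fun v =>
    Set.inter_eq_left.2 (Set.Ioi_subset_Ioi (Real.exp_pos v).le)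
  rw [integrable_prod_iff' hmeas.aestronglyMeasurable]
  constructor
  · refine Filter.Eventually.of_forall fun v => ?_
    simp only [Function.uncurry, key]
    rw [integrable_indicator_iff measurableSet_Ioi, IntegrableOn,
      Measure.restrict_restrict measurableSet_Ioi, hsub]
    exact integrableOn_Ioi_cpow_of_lt (by simp; linarith) (Real.exp_pos v)
  · have : ∀ v : ℝ, ∫ y in Set.Ioi (0 : ℝ), ‖Function.uncurry (fun (y v : ℝ) =>
        Set.indicator {p : ℝ × ℝ | Real.exp p.2 < p.1} (fun p => (p.1 : ℂ) ^ (s - 1)) (y, v))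
          (y, v)‖ = (-s.re)⁻¹ * Real.exp (s.re * v) := by
      intro v
      simp only [Function.uncurry, key, norm_indicator_eq_indicator_norm]
      rw [integral_indicator measurableSet_Ioi, Measure.restrict_restrict measurableSet_Ioi, hsub]
      have : ∀ y ∈ Set.Ioi (Real.exp v), ‖(y : ℂ) ^ (s - 1)‖ = y ^ (s.re - 1) := by
        intro y hy
        rw [Complex.norm_cpow_eq_rpow_re_of_pos ((Real.exp_pos v).trans hy)]
        simp
      rw [setIntegral_congr_fun measurableSet_Ioi this,
        integral_Ioi_rpow_of_lt (by linarith) (Real.exp_pos v), ← Real.exp_mul]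
      simp only [sub_add_cancel]
      rw [mul_comm v, neg_div, div_eq_mul_inv, inv_neg]
      ring
    simp only [this]
    exact hν.const_mul _

theorem integral_indicator_exp_lt (ν : Measure ℝ) (s : ℂ) {y : ℝ} (hy : 0 < y) :
    ∫ v, Set.indicator {p : ℝ × ℝ | Real.exp p.2 < p.1} (fun p => (p.1 : ℂ) ^ (s - 1)) (y, v) ∂ν =
      (y : ℂ) ^ (s - 1) • (ν.real (Set.Iio (Real.log y)) : ℂ) := by
  have : ∀ v : ℝ,
      Set.indicator {p : ℝ × ℝ | Real.exp p.2 < p.1} (fun p => (p.1 : ℂ) ^ (s - 1)) (y, v) =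
        (Set.Iio (Real.log y)).indicator (fun _ => (y : ℂ) ^ (s - 1)) v := by
    intro v
    simp only [Set.indicator, Set.mem_ofPred_eq, Set.mem_Iio, Real.lt_log_iff_exp_lt hy]
  simp only [this]
  rw [integral_indicator measurableSet_Iio, setIntegral_const]
  simp [mul_comm]

/-- The Mellin transform of the distribution function of `exp V`, where `V` has law `ν`, converges
at every `s` with `Re s < 0` where the exponential moment of `V` exists. -/
theorem mellinConvergent_measureReal_Iio_log {ν : Measure ℝ} [IsProbabilityMeasure ν] {s : ℂ}
    (hs : s.re < 0) (hν : Integrable (fun v => Real.exp (s.re * v)) ν) :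
    MellinConvergent (fun y => (ν.real (Set.Iio (Real.log y)) : ℂ)) s := by
  refine IntegrableOn.congr_fun (integrable_prod_exp_lt hs hν).integral_prod_left
    (fun y hy => ?_) measurableSet_Ioi
  exact integral_indicator_exp_lt ν s hy

/-- Fubini's theorem turns the Mellin transform of the distribution function of `exp V` into
`E ∫_{exp V}^∞ y^{s-1} dy = -E[exp (s V)] / s`. -/
theorem mellin_measureReal_Iio_log {ν : Measure ℝ} [IsProbabilityMeasure ν] {s : ℂ}
    (hs : s.re < 0) (hν : Integrable (fun v => Real.exp (s.re * v)) ν) :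
    mellin (fun y => (ν.real (Set.Iio (Real.log y)) : ℂ)) s = -s⁻¹ * complexMGF id ν s := by
  rw [mellin, setIntegral_congr_fun measurableSet_Ioi
    (fun y hy => (integral_indicator_exp_lt ν s hy).symm),
    integral_integral_swap (integrable_prod_exp_lt hs hν), complexMGF, ← integral_const_mul]
  refine integral_congr_ae (Filter.Eventually.of_forall fun v => ?_)
  have key : ∀ y : ℝ,
      Set.indicator {p : ℝ × ℝ | Real.exp p.2 < p.1} (fun p => (p.1 : ℂ) ^ (s - 1)) (y, v) =
        (Set.Ioi (Real.exp v)).indicator (fun y : ℝ => (y : ℂ) ^ (s - 1)) y := by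
    intro y
    simp only [Set.indicator, Set.mem_ofPred_eq, Set.mem_Ioi]
  simp only [key]
  rw [integral_indicator measurableSet_Ioi, Measure.restrict_restrict measurableSet_Ioi,
    Set.inter_eq_left.2 (Set.Ioi_subset_Ioi (Real.exp_pos v).le),
    integral_Ioi_cpow_of_lt (by simp; linarith) (Real.exp_pos v), sub_add_cancel,
    Complex.cpow_def_of_ne_zero (by exact_mod_cast (Real.exp_pos v).ne'), ← Complex.ofReal_log
    (Real.exp_pos v).le, Real.log_exp, id, mul_comm (v : ℂ)]
  rw [neg_div, div_eq_mul_inv]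
  ring

theorem continuousAt_measureReal_Iio {ν : Measure ℝ} [IsFiniteMeasure ν] {x : ℝ}
    (hx : ν {x} = 0) : ContinuousAt (fun v => ν.real (Set.Iio v)) x := by
  have h : ∀ v : ℝ, ν.real (Set.Iio v) = ∫ u, (Set.Iio v).indicator (fun _ => (1 : ℝ)) u ∂ν := by
    intro v
    rw [integral_indicator measurableSet_Iio, setIntegral_const]
    simp
  simp only [h]
  refine continuousAt_of_dominated (bound := fun _ => 1)
    (Filter.Eventually.of_forall fun v =>
      (measurable_const.indicator measurableSet_Iio).aestronglyMeasurable)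
    (Filter.Eventually.of_forall fun v => Filter.Eventually.of_forall fun u => ?_)
    (integrable_const _) ?_
  · refine (norm_indicator_le_norm_self _ _).trans (by simp)
  · have hne : ∀ᵐ u ∂ν, u ≠ x := by
      rw [ae_iff]
      simpa using hx
    filter_upwards [hne] with u hu
    -- Away from the atom-free point `x`, the indicator is locally constant in its endpoint.
    rcases lt_or_gt_of_ne hu with h1 | h1
    · refine (continuousAt_const (y := (1 : ℝ))).congr ?_
      filter_upwards [lt_mem_nhds h1] with v hv
      simp [hv]
    · refine (continuousAt_const (y := (0 : ℝ))).congr ?_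
      filter_upwards [gt_mem_nhds h1] with v hv
      simp [hv.le]

/-- Mellin inversion for a distribution function: at a continuity point `x` of the law `ν`, the
contour integral of `-E[exp (s V)] / s` recovers `ν (-∞, x)`. -/
theorem mellinInv_eq_measureReal_Iio {ν : Measure ℝ} [IsProbabilityMeasure ν] {c x : ℝ}
    (hc : c < 0) (hν : Integrable (fun v => Real.exp (c * v)) ν) (hx : ν {x} = 0) {M : ℂ → ℂ}
    (hM : ∀ s : ℂ, s.re = c → M s = -s⁻¹ * complexMGF id ν s)
    (hint : Complex.VerticalIntegrable M c) :
    mellinInv c M (Real.exp x) = ν.real (Set.Iio x) := by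
  set F : ℝ → ℂ := fun y => (ν.real (Set.Iio (Real.log y)) : ℂ) with hF
  have hMF : ∀ t : ℝ, M (c + t * Complex.I) = mellin F (c + t * Complex.I) := by
    intro t
    have hre : ((c : ℂ) + t * Complex.I).re = c := by simp
    rw [hM _ hre, mellin_measureReal_Iio_log (by rw [hre]; exact hc) (by rw [hre]; exact hν)]
  have h1 : mellinInv c M (Real.exp x) = mellinInv c (mellin F) (Real.exp x) := by
    simp only [mellinInv, hMF]
  rw [h1, mellinInv_mellin_eq c F (Real.exp_pos x)]
  · simp [hF]
  · exact mellinConvergent_measureReal_Iio_log (by simpa using hc) (by simpa using hν)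
  · exact hint.congr (Filter.Eventually.of_forall hMF)
  · refine Complex.continuous_ofReal.continuousAt.comp ?_
    have h2 : ContinuousAt (fun v => ν.real (Set.Iio v)) (Real.log (Real.exp x)) := by
      rw [Real.log_exp]
      exact continuousAt_measureReal_Iio hx
    exact h2.comp (f := Real.log) (Real.continuousAt_log (Real.exp_pos x).ne')

/-! ### The integral of Tricomi's function and its decay on vertical lines -/

/-- The real weight `e^{-zt} t^{a-1}` of the integral defining Tricomi's function. -/
noncomputable def tricomiWeight (a z t : ℝ) : ℝ := Real.exp (-z * t) * t ^ (a - 1)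

/-- The integral `∫_0^∞ e^{-zt} t^{a-1} (1+t)^w dt`, that is `Γ(a) Ψ(a, a + 1 + w; z)`. -/
noncomputable def tricomiIntegral (a z : ℝ) (w : ℂ) : ℂ :=
  ∫ t in Set.Ioi (0 : ℝ), (tricomiWeight a z t : ℂ) * ((1 + t : ℝ) : ℂ) ^ w

theorem tricomiPsi_eq_tricomiIntegral (a z : ℝ) (w : ℂ) :
    tricomiPsi a (a + 1 + w) z = (Complex.Gamma a)⁻¹ * tricomiIntegral a z w := by
  have h : (a + 1 + w - a - 1 : ℂ) = w := by ring
  simp only [tricomiPsi, tricomiIntegral, tricomiWeight, h, Complex.ofReal_mul]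

theorem tricomiWeight_nonneg (a z : ℝ) {t : ℝ} (ht : 0 < t) : 0 ≤ tricomiWeight a z t :=
  mul_nonneg (Real.exp_pos _).le (Real.rpow_nonneg ht.le _)

theorem integrableOn_tricomiWeight_mul_rpow {a z : ℝ} (ha : 0 < a) (hz : 0 < z) (p : ℝ) :
    IntegrableOn (fun t => tricomiWeight a z t * (1 + t) ^ p) (Set.Ioi 0) := by
  obtain ⟨n, hn⟩ := exists_nat_ge p
  -- `(1 + t)^n` is absorbed by half of the exponential decay.
  have hbase : IntegrableOn (fun t : ℝ => t ^ (a - 1) * Real.exp (-(z / 2) * t ^ (1 : ℝ)))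
      (Set.Ioi 0) :=
    integrableOn_rpow_mul_exp_neg_mul_rpow (by linarith) one_pos (by positivity)
  refine Integrable.mono' (hbase.const_mul (n.factorial / (z / 2) ^ n * Real.exp (z / 2))) ?_ ?_
  · refine Measurable.aestronglyMeasurable ?_
    unfold tricomiWeight
    fun_prop
  · refine (ae_restrict_iff' measurableSet_Ioi).2 (Filter.Eventually.of_forall fun t ht => ?_)
    have ht : 0 < t := ht
    have h1 : (1 + t) ^ p ≤ (1 + t) ^ n := by
      rw [← Real.rpow_natCast]
      exact Real.rpow_le_rpow_of_exponent_le (by linarith) hn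
    have h2 := Real.pow_div_factorial_le_exp (z / 2 * (1 + t)) (by positivity) n
    have h3 : (1 + t) ^ n ≤ n.factorial / (z / 2) ^ n * Real.exp (z / 2 * (1 + t)) := by
      rw [mul_pow, div_le_iff₀ (by positivity)] at h2
      rw [div_mul_eq_mul_div, le_div_iff₀ (by positivity)]
      linarith
    rw [Real.norm_of_nonneg (mul_nonneg (tricomiWeight_nonneg a z ht) (by positivity))]
    refine (mul_le_mul_of_nonneg_left (h1.trans h3) (tricomiWeight_nonneg a z ht)).trans_eq ?_
    have h4 : Real.exp (-z * t) * Real.exp (z / 2 * (1 + t)) =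
        Real.exp (z / 2) * Real.exp (-(z / 2) * t) := by
      rw [← Real.exp_add, ← Real.exp_add]
      congr 1
      ring
    rw [tricomiWeight, Real.rpow_one]
    linear_combination (n.factorial / (z / 2) ^ n * t ^ (a - 1)) * h4

theorem norm_tricomiIntegrand (a z : ℝ) (w : ℂ) {t : ℝ} (ht : 0 < t) :
    ‖(tricomiWeight a z t : ℂ) * ((1 + t : ℝ) : ℂ) ^ w‖ =
      tricomiWeight a z t * (1 + t) ^ w.re := by
  rw [norm_mul, Complex.norm_real, Real.norm_of_nonneg (tricomiWeight_nonneg a z ht),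
    Complex.norm_cpow_eq_rpow_re_of_pos (by linarith)]

theorem integrableOn_tricomiIntegrand {a z : ℝ} (ha : 0 < a) (hz : 0 < z) (w : ℂ) :
    IntegrableOn (fun t => (tricomiWeight a z t : ℂ) * ((1 + t : ℝ) : ℂ) ^ w) (Set.Ioi 0) := by
  refine Integrable.mono' (integrableOn_tricomiWeight_mul_rpow ha hz w.re) ?_ ?_
  · refine Measurable.aestronglyMeasurable ?_
    unfold tricomiWeight
    fun_prop
  · refine (ae_restrict_iff' measurableSet_Ioi).2 (Filter.Eventually.of_forall fun t ht => ?_)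
    exact (norm_tricomiIntegrand a z w ht).le

theorem norm_tricomiIntegral_le {a z : ℝ} (w : ℂ) :
    ‖tricomiIntegral a z w‖ ≤ ∫ t in Set.Ioi (0 : ℝ), tricomiWeight a z t * (1 + t) ^ w.re := by
  refine (norm_integral_le_integral_norm _).trans_eq ?_
  exact setIntegral_congr_fun measurableSet_Ioi fun t ht => norm_tricomiIntegrand a z w ht

theorem hasDerivAt_tricomiWeight (a z : ℝ) {t : ℝ} (ht : 0 < t) :
    HasDerivAt (tricomiWeight a z) (((a - 1) / t - z) * tricomiWeight a z t) t := by
  have h1 : HasDerivAt (fun t : ℝ => Real.exp (-z * t)) (Real.exp (-z * t) * (-z * 1)) t :=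
    ((hasDerivAt_id t).const_mul (-z)).exp
  have h2 := Real.hasDerivAt_rpow_const (x := t) (p := a - 1) (Or.inl ht.ne')
  refine (h1.mul h2).congr_deriv ?_
  rw [tricomiWeight, Real.rpow_sub_one ht.ne' (a - 1)]
  field_simp
  ring

/-- The head of the integral, over `(0, ε]`, is `O(ε^a)` uniformly in `Im w`. -/
theorem norm_integral_Ioc_tricomiIntegrand_le {a z : ℝ} (ha : 0 < a) (hz : 0 < z) (w : ℂ) {ε : ℝ}
    (hε : 0 < ε) (hε1 : ε ≤ 1) :
    ‖∫ t in Set.Ioc 0 ε, (tricomiWeight a z t : ℂ) * ((1 + t : ℝ) : ℂ) ^ w‖ ≤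
      2 ^ |w.re| / a * ε ^ a := by
  have hint : IntegrableOn (fun t : ℝ => 2 ^ |w.re| * t ^ (a - 1)) (Set.Ioc 0 ε) := by
    rw [← intervalIntegrable_iff_integrableOn_Ioc_of_le hε.le]
    exact (intervalIntegral.intervalIntegrable_rpow' (by linarith)).const_mul _
  refine (norm_integral_le_of_norm_le hint ?_).trans_eq ?_
  · refine (ae_restrict_iff' measurableSet_Ioc).2 (Filter.Eventually.of_forall fun t ht => ?_)
    obtain ⟨ht0, ht1⟩ := ht
    rw [norm_tricomiIntegrand a z w ht0, mul_comm]
    refine mul_le_mul ?_ ?_ (tricomiWeight_nonneg a z ht0) (by positivity)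
    · calc (1 + t) ^ w.re ≤ (1 + t) ^ |w.re| :=
            Real.rpow_le_rpow_of_exponent_le (by linarith) (le_abs_self _)
        _ ≤ 2 ^ |w.re| := Real.rpow_le_rpow (by linarith) (by linarith) (abs_nonneg _)
    · refine mul_le_of_le_one_left (Real.rpow_nonneg ht0.le _) (Real.exp_le_one_iff.2 ?_)
      nlinarith
  · rw [integral_const_mul, ← intervalIntegral.integral_of_le hε.le,
      integral_rpow (Or.inl (by linarith)), sub_add_cancel, Real.zero_rpow ha.ne']
    ring

/-- The tail of the integral, over `(ε, ∞)`, is integrated by parts against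
`(1+t)^w = d/dt (1+t)^{w+1} / (w+1)`; on the tail the logarithmic derivative of the weight is at
most `|a - 1| / ε + z`. -/
theorem norm_integral_Ioi_tricomiIntegrand_le {a z : ℝ} (ha : 0 < a) (hz : 0 < z) {w : ℂ}
    (hw : w + 1 ≠ 0) {ε : ℝ} (hε : 0 < ε) (hε1 : ε ≤ 1) :
    ‖∫ t in Set.Ioi ε, (tricomiWeight a z t : ℂ) * ((1 + t : ℝ) : ℂ) ^ w‖ ≤
      (2 ^ |w.re + 1| * ε ^ (a - 1) + (|a - 1| / ε + z) *
        ∫ t in Set.Ioi (0 : ℝ), tricomiWeight a z t * (1 + t) ^ (w.re + 1)) / ‖w + 1‖ := by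
  set P : ℝ → ℂ := fun t => ((1 + t : ℝ) : ℂ) ^ (w + 1) / (w + 1) with hP
  have hsub : Set.Ioi ε ⊆ Set.Ioi 0 := Set.Ioi_subset_Ioi hε.le
  have hPd : ∀ t : ℝ, 0 < t → HasDerivAt P (((1 + t : ℝ) : ℂ) ^ w) t := by
    intro t ht
    have h1 : HasDerivAt (fun u : ℂ => (1 + u) ^ (w + 1))
        ((w + 1) * (1 + (t : ℂ)) ^ (w + 1 - 1) * 1) (t : ℂ) := by
      refine ((hasDerivAt_id (t : ℂ)).const_add 1).cpow_const ?_
      change 1 + (t : ℂ) ∈ Complex.slitPlane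
      exact_mod_cast Complex.ofReal_mem_slitPlane.2 (by linarith : 0 < 1 + t)
    have h2 : HasDerivAt (fun t : ℝ => ((1 + t : ℝ) : ℂ) ^ (w + 1))
        ((w + 1) * (1 + (t : ℂ)) ^ (w + 1 - 1) * 1) t := by
      simpa only [Complex.ofReal_add, Complex.ofReal_one] using h1.comp_ofReal
    refine (h2.div_const (w + 1)).congr_deriv ?_
    rw [add_sub_cancel_right, Complex.ofReal_add, Complex.ofReal_one]
    field_simp
  have hQd : ∀ t : ℝ, 0 < t → HasDerivAt (fun t => (tricomiWeight a z t : ℂ))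
      (((a - 1) / t - z : ℝ) * (tricomiWeight a z t : ℂ)) t := by
    intro t ht
    refine (hasDerivAt_tricomiWeight a z ht).ofReal_comp.congr_deriv ?_
    push_cast
    ring
  have hnP : ∀ t : ℝ, 0 < t → ‖P t‖ = (1 + t) ^ (w.re + 1) / ‖w + 1‖ := by
    intro t ht
    rw [hP, norm_div, Complex.norm_cpow_eq_rpow_re_of_pos (by linarith)]
    simp
  have hwpos : 0 < ‖w + 1‖ := norm_pos_iff.2 hw
  have hPc : ContinuousOn P (Set.Ioi 0) := fun t ht => (hPd t ht).continuousAt.continuousWithinAt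
  -- the three integrable functions in the integration by parts
  have hI1 : IntegrableOn (fun t => (tricomiWeight a z t : ℂ) * ((1 + t : ℝ) : ℂ) ^ w)
      (Set.Ioi ε) := (integrableOn_tricomiIntegrand ha hz w).mono_set hsub
  have hI2 : IntegrableOn (fun t => (tricomiWeight a z t : ℂ) * P t) (Set.Ioi ε) := by
    refine (((integrableOn_tricomiIntegrand ha hz (w + 1)).mono_set hsub).div_const (w + 1)).congr
      (Filter.Eventually.of_forall fun t => ?_)
    simp only [hP, mul_div_assoc]
  have hJ : IntegrableOn (fun t => tricomiWeight a z t * (1 + t) ^ (w.re + 1)) (Set.Ioi ε) :=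
    (integrableOn_tricomiWeight_mul_rpow ha hz _).mono_set hsub
  have hbound : ∀ t ∈ Set.Ioi ε,
      ‖((((a - 1) / t - z : ℝ) : ℂ) * (tricomiWeight a z t : ℂ)) * P t‖ ≤
        (|a - 1| / ε + z) / ‖w + 1‖ * (tricomiWeight a z t * (1 + t) ^ (w.re + 1)) := by
    intro t ht
    have ht0 : 0 < t := hsub ht
    have ht1 : ε < t := ht
    rw [norm_mul, norm_mul, hnP t ht0, Complex.norm_real, Complex.norm_real,
      Real.norm_of_nonneg (tricomiWeight_nonneg a z ht0), Real.norm_eq_abs]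
    have h1 : |(a - 1) / t - z| ≤ |a - 1| / ε + z := by
      refine (abs_sub _ _).trans ?_
      rw [abs_div, abs_of_pos ht0, abs_of_pos hz]
      gcongr
    have h2 : 0 ≤ tricomiWeight a z t * ((1 + t) ^ (w.re + 1) / ‖w + 1‖) :=
      mul_nonneg (tricomiWeight_nonneg a z ht0) (by positivity)
    calc |(a - 1) / t - z| * tricomiWeight a z t * ((1 + t) ^ (w.re + 1) / ‖w + 1‖)
        = |(a - 1) / t - z| * (tricomiWeight a z t * ((1 + t) ^ (w.re + 1) / ‖w + 1‖)) := by ring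
      _ ≤ (|a - 1| / ε + z) * (tricomiWeight a z t * ((1 + t) ^ (w.re + 1) / ‖w + 1‖)) :=
          mul_le_mul_of_nonneg_right h1 h2
      _ = _ := by ring
  have hI3 : IntegrableOn
      (fun t => ((((a - 1) / t - z : ℝ) : ℂ) * (tricomiWeight a z t : ℂ)) * P t)
      (Set.Ioi ε) := by
    refine Integrable.mono' (hJ.const_mul ((|a - 1| / ε + z) / ‖w + 1‖)) ?_
      ((ae_restrict_iff' measurableSet_Ioi).2 (Filter.Eventually.of_forall hbound))
    refine Measurable.aestronglyMeasurable ?_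
    simp only [hP]
    unfold tricomiWeight
    fun_prop
  have hder : ∀ t : ℝ, 0 < t → HasDerivAt (fun t => (tricomiWeight a z t : ℂ) * P t)
      (((((a - 1) / t - z : ℝ) : ℂ) * (tricomiWeight a z t : ℂ)) * P t +
        (tricomiWeight a z t : ℂ) * ((1 + t : ℝ) : ℂ) ^ w) t :=
    fun t ht => (hQd t ht).mul (hPd t ht)
  have hI4 := hI3.add hI1
  have hlim := tendsto_zero_of_hasDerivAt_of_integrableOn_Ioi
    (fun t ht => hder t (hsub ht)) hI4 hI2
  have hFTC := integral_Ioi_of_hasDerivAt_of_tendsto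
    (hder ε hε).continuousAt.continuousWithinAt (fun t ht => hder t (hsub ht)) hI4 hlim
  rw [integral_add hI3 hI1] at hFTC
  have hsplit : ∫ t in Set.Ioi ε, (tricomiWeight a z t : ℂ) * ((1 + t : ℝ) : ℂ) ^ w =
      -((tricomiWeight a z ε : ℂ) * P ε) -
        ∫ t in Set.Ioi ε, ((((a - 1) / t - z : ℝ) : ℂ) * (tricomiWeight a z t : ℂ)) * P t := by
    linear_combination hFTC
  have hB : ‖(tricomiWeight a z ε : ℂ) * P ε‖ ≤ 2 ^ |w.re + 1| * ε ^ (a - 1) / ‖w + 1‖ := by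
    rw [norm_mul, hnP ε hε, Complex.norm_real, Real.norm_of_nonneg (tricomiWeight_nonneg a z hε),
      ← mul_div_assoc, mul_comm]
    refine div_le_div_of_nonneg_right ?_ hwpos.le
    refine mul_le_mul ?_ ?_ (tricomiWeight_nonneg a z hε) (by positivity)
    · calc (1 + ε) ^ (w.re + 1) ≤ (1 + ε) ^ |w.re + 1| :=
            Real.rpow_le_rpow_of_exponent_le (by linarith) (le_abs_self _)
        _ ≤ 2 ^ |w.re + 1| := Real.rpow_le_rpow (by linarith) (by linarith) (abs_nonneg _)
    · refine mul_le_of_le_one_left (Real.rpow_nonneg hε.le _) (Real.exp_le_one_iff.2 ?_)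
      nlinarith
  have hR : ‖∫ t in Set.Ioi ε, ((((a - 1) / t - z : ℝ) : ℂ) * (tricomiWeight a z t : ℂ)) * P t‖ ≤
      (|a - 1| / ε + z) / ‖w + 1‖ *
        ∫ t in Set.Ioi (0 : ℝ), tricomiWeight a z t * (1 + t) ^ (w.re + 1) := by
    refine (norm_integral_le_of_norm_le (hJ.const_mul _)
      ((ae_restrict_iff' measurableSet_Ioi).2 (Filter.Eventually.of_forall hbound))).trans ?_
    rw [integral_const_mul]
    refine mul_le_mul_of_nonneg_left ?_ (by positivity)
    refine setIntegral_mono_set (integrableOn_tricomiWeight_mul_rpow ha hz _) ?_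
      (Filter.Eventually.of_forall hsub)
    refine (ae_restrict_iff' measurableSet_Ioi).2 (Filter.Eventually.of_forall fun t ht => ?_)
    have ht : 0 < t := ht
    exact mul_nonneg (tricomiWeight_nonneg a z ht) (by positivity)
  rw [hsplit]
  refine (norm_sub_le _ _).trans ?_
  rw [norm_neg]
  refine (add_le_add hB hR).trans_eq ?_
  ring

/-- Along vertical lines the integral decays like a negative power of `|Im w|`: it is cut at
`ε = |Im w|^{-1/2}`, which balances the head against the tail. -/
theorem exists_norm_tricomiIntegral_le_rpow {a z : ℝ} (ha : 0 < a) (hz : 0 < z) (c : ℝ) :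
    ∃ C δ : ℝ, 0 < δ ∧ ∀ w : ℂ, w.re = c → 1 ≤ |w.im| →
      ‖tricomiIntegral a z w‖ ≤ C * |w.im| ^ (-δ) := by
  set J := ∫ t in Set.Ioi (0 : ℝ), tricomiWeight a z t * (1 + t) ^ (c + 1) with hJdef
  have hJ : 0 ≤ J := setIntegral_nonneg measurableSet_Ioi fun t ht =>
    mul_nonneg (tricomiWeight_nonneg a z ht) (Real.rpow_nonneg (by linarith [Set.mem_Ioi.1 ht]) _)
  set d := min a 1 with hd
  have hdpos : 0 < d := lt_min ha one_pos
  refine ⟨2 ^ |c| / a + (2 ^ |c + 1| + (|a - 1| + z) * J), d / 2, by positivity,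
    fun w hwc hw => ?_⟩
  have hτ : 0 < |w.im| := by linarith
  set ε := |w.im| ^ (-(1 / 2) : ℝ) with hεdef
  have hε : 0 < ε := Real.rpow_pos_of_pos hτ _
  have hε1 : ε ≤ 1 := Real.rpow_le_one_of_one_le_of_nonpos hw (by norm_num)
  have hεsq : ε * ε = |w.im|⁻¹ := by
    rw [hεdef, ← Real.rpow_add hτ, ← Real.rpow_neg_one]
    norm_num
  have hεd : |w.im| ^ (-(d / 2)) = ε ^ d := by
    rw [hεdef, ← Real.rpow_mul hτ.le]
    congr 1
    ring
  have hnorm : |w.im| ≤ ‖w + 1‖ := by simpa using Complex.abs_im_le_norm (w + 1)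
  have hw1 : w + 1 ≠ 0 := by
    intro h
    rw [h, norm_zero] at hnorm
    linarith
  have hinv : ‖w + 1‖⁻¹ ≤ ε * ε := by
    rw [hεsq]
    exact inv_anti₀ hτ hnorm
  have hsplit : tricomiIntegral a z w =
      (∫ t in Set.Ioc 0 ε, (tricomiWeight a z t : ℂ) * ((1 + t : ℝ) : ℂ) ^ w) +
        ∫ t in Set.Ioi ε, (tricomiWeight a z t : ℂ) * ((1 + t : ℝ) : ℂ) ^ w := by
    have hI := integrableOn_tricomiIntegrand ha hz w
    rw [tricomiIntegral, ← Set.Ioc_union_Ioi_eq_Ioi hε.le, setIntegral_union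
      (Set.Ioc_disjoint_Ioi le_rfl) measurableSet_Ioi (hI.mono_set Set.Ioc_subset_Ioi_self)
      (hI.mono_set (Set.Ioi_subset_Ioi hε.le))]
  have h1 := norm_integral_Ioc_tricomiIntegrand_le ha hz w hε hε1
  have h2 := norm_integral_Ioi_tricomiIntegrand_le ha hz hw1 hε hε1
  rw [hwc, ← hJdef] at h2
  rw [hwc] at h1
  have hpa : ε ^ a ≤ ε ^ d := Real.rpow_le_rpow_of_exponent_ge hε hε1 (min_le_left _ _)
  have hp1 : ε ≤ ε ^ d := by
    simpa using Real.rpow_le_rpow_of_exponent_ge hε hε1 (min_le_right a 1)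
  have h3 : ‖∫ t in Set.Ioi ε, (tricomiWeight a z t : ℂ) * ((1 + t : ℝ) : ℂ) ^ w‖ ≤
      (2 ^ |c + 1| + (|a - 1| + z) * J) * ε ^ d := by
    refine h2.trans ?_
    rw [div_eq_mul_inv]
    calc _ ≤ (2 ^ |c + 1| * ε ^ (a - 1) + (|a - 1| / ε + z) * J) * (ε * ε) := by
          gcongr
      _ = 2 ^ |c + 1| * (ε * ε ^ a) + (|a - 1| + ε * z) * J * ε := by
          rw [Real.rpow_sub_one hε.ne']
          field_simp
      _ ≤ 2 ^ |c + 1| * (1 * ε ^ d) + (|a - 1| + 1 * z) * J * ε ^ d := by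
          gcongr
      _ = _ := by ring
  have h4 : 2 ^ |c| / a * ε ^ a ≤ 2 ^ |c| / a * ε ^ d := by gcongr
  rw [hsplit, hεd]
  refine (norm_add_le _ _).trans ?_
  linarith

/-! ### Integration against the Gamma distribution -/

theorem gammaPDFReal_eq_tricomiWeight {a r γ : ℝ} (hr : 0 < r) (hγ : 0 < γ) {x : ℝ}
    (hx : 0 < x) : gammaPDFReal a r x =
      γ * ((r / γ) ^ a / Real.Gamma a * tricomiWeight a (r / γ) (γ * x)) := by
  rw [gammaPDFReal, if_pos hx.le, tricomiWeight, Real.mul_rpow hγ.le hx.le,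
    Real.rpow_sub_one hγ.ne', Real.div_rpow hr.le hγ.le]
  have h1 : -(r / γ) * (γ * x) = -(r * x) := by field_simp
  rw [h1]
  have h2 : 0 < γ ^ a := Real.rpow_pos_of_pos hγ _
  field_simp

theorem integral_gammaMeasure {E : Type*} [NormedAddCommGroup E] [NormedSpace ℝ E] {a r : ℝ}
    (ha : 0 < a) (hr : 0 < r) (f : ℝ → E) :
    ∫ x, f x ∂gammaMeasure a r = ∫ x in Set.Ioi 0, gammaPDFReal a r x • f x := by
  rw [gammaMeasure, integral_withDensity_eq_integral_toReal_smul
    (show Measurable (gammaPDF a r) from (measurable_gammaPDFReal a r).ennreal_ofReal)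
    (Filter.Eventually.of_forall fun x => by
      simp [gammaPDF])]
  simp only [gammaPDF, ENNReal.toReal_ofReal (gammaPDFReal_nonneg ha hr _)]
  rw [← integral_Ici_eq_integral_Ioi, setIntegral_eq_integral_of_forall_compl_eq_zero]
  intro x hx
  rw [gammaPDFReal, if_neg (by simpa using hx), zero_smul]

theorem integrable_gammaMeasure {E : Type*} [NormedAddCommGroup E] [NormedSpace ℝ E] {a r : ℝ}
    (ha : 0 < a) (hr : 0 < r) {f : ℝ → E}
    (hf : IntegrableOn (fun x => gammaPDFReal a r x • f x) (Set.Ioi 0)) :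
    Integrable f (gammaMeasure a r) := by
  rw [gammaMeasure, integrable_withDensity_iff_integrable_smul'
    (show Measurable (gammaPDF a r) from (measurable_gammaPDFReal a r).ennreal_ofReal)
    (Filter.Eventually.of_forall fun x => by
      simp [gammaPDF])]
  simp only [gammaPDF, ENNReal.toReal_ofReal (gammaPDFReal_nonneg ha hr _)]
  rw [← integrableOn_Ici_iff_integrableOn_Ioi] at hf
  refine (integrableOn_iff_integrable_of_support_subset fun x hx => ?_).1 hf
  by_contra h
  have h0 : ¬ 0 ≤ x := h
  exact hx (by simp [gammaPDFReal, h0])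

theorem integral_comp_mul_gammaMeasure {a r γ : ℝ} (ha : 0 < a) (hr : 0 < r) (hγ : 0 < γ)
    (f : ℝ → ℂ) : ∫ x, f (γ * x) ∂gammaMeasure a r =
      ((r / γ) ^ a / Real.Gamma a : ℝ) *
        ∫ t in Set.Ioi (0 : ℝ), (tricomiWeight a (r / γ) t : ℂ) * f t := by
  have h : ∀ x ∈ Set.Ioi (0 : ℝ), gammaPDFReal a r x • f (γ * x) =
      (γ : ℂ) * (fun t : ℝ => (((r / γ) ^ a / Real.Gamma a : ℝ) : ℂ) *
        ((tricomiWeight a (r / γ) t : ℂ) * f t)) (γ * x) := by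
    intro x hx
    rw [gammaPDFReal_eq_tricomiWeight hr hγ hx, Complex.real_smul]
    push_cast
    ring
  rw [integral_gammaMeasure ha hr, setIntegral_congr_fun measurableSet_Ioi h, integral_const_mul,
    integral_comp_mul_left_Ioi (fun t : ℝ => (((r / γ) ^ a / Real.Gamma a : ℝ) : ℂ) *
      ((tricomiWeight a (r / γ) t : ℂ) * f t)) 0 hγ, mul_zero, integral_const_mul, Complex.real_smul,
    ← mul_assoc, Complex.ofReal_inv, mul_inv_cancel₀ (by exact_mod_cast hγ.ne'), one_mul]

theorem integrable_comp_mul_gammaMeasure {a r γ : ℝ} (ha : 0 < a) (hr : 0 < r) (hγ : 0 < γ)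
    {f : ℝ → ℝ} (hf : IntegrableOn (fun t => tricomiWeight a (r / γ) t * f t) (Set.Ioi 0)) :
    Integrable (fun x => f (γ * x)) (gammaMeasure a r) := by
  refine integrable_gammaMeasure ha hr ?_
  have h1 : IntegrableOn (fun x => tricomiWeight a (r / γ) (γ * x) * f (γ * x)) (Set.Ioi 0) :=
    (integrableOn_Ioi_comp_mul_left_iff _ 0 hγ).2 (by rwa [mul_zero])
  refine IntegrableOn.congr_fun (h1.const_mul (γ * ((r / γ) ^ a / Real.Gamma a)))
    (fun x hx => ?_) measurableSet_Ioi
  simp only [smul_eq_mul]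
  rw [gammaPDFReal_eq_tricomiWeight hr hγ hx]
  ring

/-! ### The factors of the kernel as moments -/

/-- The logarithm `ρ (log A + log (1 + γ x))` of `(A (1 + γ x))^ρ`, for `A > 0` and `1 + γ x > 0`.
Gamma variables are almost surely positive, so for `γ > 0` other arguments do not matter. -/
noncomputable def scaledLogRate (A ρ γ x : ℝ) : ℝ := ρ * (Real.log A + Real.log (1 + γ * x))

@[fun_prop]
theorem measurable_scaledLogRate (A ρ γ : ℝ) : Measurable (scaledLogRate A ρ γ) := by
  unfold scaledLogRate
  fun_prop

theorem cexp_mul_scaledLogRate {A : ℝ} (hA : 0 < A) (ρ : ℝ) (s : ℂ) {t : ℝ} (ht : 0 < t) :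
    Complex.exp (s * (ρ * (Real.log A + Real.log (1 + t)) : ℝ)) =
      (A : ℂ) ^ (ρ * s) * ((1 + t : ℝ) : ℂ) ^ (ρ * s) := by
  have h1t : 0 < 1 + t := by linarith
  rw [Complex.cpow_def_of_ne_zero (by exact_mod_cast hA.ne'),
    Complex.cpow_def_of_ne_zero (by exact_mod_cast h1t.ne'), ← Complex.ofReal_log hA.le,
    ← Complex.ofReal_log h1t.le, ← Complex.exp_add]
  congr 1
  push_cast
  ring

theorem integrable_exp_mul_scaledLogRate {a r γ : ℝ} (ha : 0 < a) (hr : 0 < r) (hγ : 0 < γ)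
    (ρ t : ℝ) :
    Integrable (fun x => Real.exp (t * scaledLogRate (r / γ) ρ γ x)) (gammaMeasure a r) := by
  have hA : 0 < r / γ := div_pos hr hγ
  refine integrable_comp_mul_gammaMeasure ha hr hγ
    (f := fun u => Real.exp (t * (ρ * (Real.log (r / γ) + Real.log (1 + u))))) ?_
  refine IntegrableOn.congr_fun
    ((integrableOn_tricomiWeight_mul_rpow ha hA (ρ * t)).const_mul ((r / γ) ^ (ρ * t)))
    (fun u hu => ?_) measurableSet_Ioi
  have hu : 0 < 1 + u := by linarith [Set.mem_Ioi.1 hu]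
  have : Real.exp (t * (ρ * (Real.log (r / γ) + Real.log (1 + u)))) =
      (r / γ) ^ (ρ * t) * (1 + u) ^ (ρ * t) := by
    rw [Real.rpow_def_of_pos hA, Real.rpow_def_of_pos hu, ← Real.exp_add]
    congr 1
    ring
  simp only [this]
  ring

theorem foxXi_eq_tricomiIntegral {a A : ℝ} (hA : 0 < A) (ρ : ℝ) (s : ℂ) :
    foxXi ⟨1, ρ, A, a⟩ s =
      (A : ℂ) ^ (a + ρ * s) * ((Complex.Gamma a)⁻¹ * tricomiIntegral a A (ρ * s)) := by
  have h1 : (a : ℂ) + (1 : ℝ) + ρ * s - 1 = a + ρ * s := by push_cast; ring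
  have h2 : (a : ℂ) + (1 : ℝ) + ρ * s = a + 1 + ρ * s := by push_cast; ring
  simp only [foxXi, hA.ne', if_false]
  rw [h1, h2, tricomiPsi_eq_tricomiIntegral]

/-- The factor `Ξ(1, ρ, r/γ, a)(s)` is the moment `E[(A (1 + γ X))^{ρ s}]` of a Gamma variable `X`
of shape `a` and rate `r`, with `A = r/γ`. -/
theorem foxXi_eq_complexMGF {a r γ : ℝ} (ha : 0 < a) (hr : 0 < r) (hγ : 0 < γ) (ρ : ℝ) :
    foxXi ⟨1, ρ, r / γ, a⟩ = complexMGF (scaledLogRate (r / γ) ρ γ) (gammaMeasure a r) := by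
  ext s
  have hA : 0 < r / γ := div_pos hr hγ
  have h : ∀ t ∈ Set.Ioi (0 : ℝ), (tricomiWeight a (r / γ) t : ℂ) *
      Complex.exp (s * (ρ * (Real.log (r / γ) + Real.log (1 + t)) : ℝ)) =
        ((r / γ : ℝ) : ℂ) ^ (ρ * s) *
          ((tricomiWeight a (r / γ) t : ℂ) * ((1 + t : ℝ) : ℂ) ^ (ρ * s)) := by
    intro t ht
    rw [cexp_mul_scaledLogRate hA ρ s ht]
    ring
  have h2 := integral_comp_mul_gammaMeasure ha hr hγ
    (fun t => Complex.exp (s * (ρ * (Real.log (r / γ) + Real.log (1 + t)) : ℝ)))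
  rw [setIntegral_congr_fun measurableSet_Ioi h, integral_const_mul] at h2
  rw [foxXi_eq_tricomiIntegral hA, complexMGF]
  refine Eq.trans ?_ h2.symm
  rw [Complex.cpow_add _ _ (Complex.ofReal_ne_zero.2 hA.ne'), Complex.ofReal_div ((r / γ) ^ a),
    Complex.ofReal_cpow hA.le, ← Complex.Gamma_ofReal, tricomiIntegral]
  ring

theorem analyticAt_foxXi_of_pos {a A : ℝ} (ha : 0 < a) (hA : 0 < A) (ρ : ℝ) (s : ℂ) :
    AnalyticAt ℂ (foxXi ⟨1, ρ, A, a⟩) s := by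
  have h := foxXi_eq_complexMGF ha hA one_pos ρ
  rw [div_one] at h
  rw [h]
  refine analyticAt_complexMGF ?_
  have huniv : integrableExpSet (scaledLogRate A ρ 1) (gammaMeasure a A) = Set.univ := by
    refine Set.eq_univ_of_forall fun t => ?_
    have := integrable_exp_mul_scaledLogRate ha hA one_pos ρ t
    rwa [div_one] at this
  simp [huniv]

/-! ### Integrability along vertical lines -/

theorem exists_norm_foxXi_le {a A : ℝ} (hA : 0 < A) (ρ c : ℝ) :
    ∃ B : ℝ, ∀ s : ℂ, s.re = c → ‖foxXi ⟨1, ρ, A, a⟩ s‖ ≤ B := by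
  refine ⟨A ^ (a + ρ * c) * (‖(Complex.Gamma a)⁻¹‖ *
    ∫ t in Set.Ioi (0 : ℝ), tricomiWeight a A t * (1 + t) ^ (ρ * c)), fun s hs => ?_⟩
  rw [foxXi_eq_tricomiIntegral hA, norm_mul, norm_mul, Complex.norm_cpow_eq_rpow_re_of_pos hA]
  have h1 : ((a : ℂ) + ρ * s).re = a + ρ * c := by simp [hs]
  have h2 : ((ρ : ℂ) * s).re = ρ * c := by simp [hs]
  have h3 := norm_tricomiIntegral_le (a := a) (z := A) ((ρ : ℂ) * s)
  rw [h2] at h3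
  rw [h1]
  gcongr

theorem exists_norm_foxXi_le_rpow {a A ρ : ℝ} (ha : 0 < a) (hA : 0 < A) (hρ : 0 < ρ) (c : ℝ) :
    ∃ C δ : ℝ, 0 < δ ∧ ∀ s : ℂ, s.re = c → ρ⁻¹ ≤ |s.im| →
      ‖foxXi ⟨1, ρ, A, a⟩ s‖ ≤ C * |s.im| ^ (-δ) := by
  obtain ⟨C, δ, hδ, h⟩ := exists_norm_tricomiIntegral_le_rpow ha hA (ρ * c)
  refine ⟨A ^ (a + ρ * c) * (‖(Complex.Gamma a)⁻¹‖ * (C * ρ ^ (-δ))), δ, hδ, fun s hs him => ?_⟩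
  rw [foxXi_eq_tricomiIntegral hA, norm_mul, norm_mul, Complex.norm_cpow_eq_rpow_re_of_pos hA]
  have h1 : ((a : ℂ) + ρ * s).re = a + ρ * c := by simp [hs]
  have h2 : ((ρ : ℂ) * s).im = ρ * s.im := by simp
  have h3 := h ((ρ : ℂ) * s) (by simp [hs]) (by
    rw [h2, abs_mul, abs_of_pos hρ, mul_comm]
    exact (inv_le_iff_one_le_mul₀ hρ).1 him)
  rw [h2, abs_mul, abs_of_pos hρ, Real.mul_rpow hρ.le (abs_nonneg _)] at h3
  rw [h1]
  calc _ ≤ A ^ (a + ρ * c) * (‖(Complex.Gamma a)⁻¹‖ * (C * (ρ ^ (-δ) * |s.im| ^ (-δ)))) := by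
        gcongr
    _ = _ := by ring

/-- A product of the factors, divided by `s`, is integrable along a vertical line: each factor is
bounded there, and the decay of a single one supplies the power of `|s|` that `1/s` lacks. -/
theorem verticalIntegrable_inv_mul_prod_foxXi {ι : Type*} [Fintype ι] [Nonempty ι] {a A ρ : ι → ℝ}
    (ha : ∀ i, 0 < a i) (hA : ∀ i, 0 < A i) (hρ : ∀ i, 0 < ρ i) {c : ℝ} (hc : c ≠ 0) :
    Complex.VerticalIntegrable (fun s => -s⁻¹ * ∏ i, foxXi ⟨1, ρ i, A i, a i⟩ s) c := by
  classical
  obtain ⟨i₀⟩ := ‹Nonempty ι›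
  choose B hB using fun i => exists_norm_foxXi_le (a := a i) (hA i) (ρ i) c
  obtain ⟨C, δ, hδ, hC⟩ := exists_norm_foxXi_le_rpow (ha i₀) (hA i₀) (hρ i₀) c
  have hre : ∀ t : ℝ, ((c : ℂ) + t * Complex.I).re = c := by simp
  have him : ∀ t : ℝ, ((c : ℂ) + t * Complex.I).im = t := by simp
  have hne : ∀ t : ℝ, (c : ℂ) + t * Complex.I ≠ 0 := by
    intro t h
    exact hc (by rw [← hre t, h, Complex.zero_re])
  have hcont : Continuous fun t : ℝ =>
      -((c : ℂ) + t * Complex.I)⁻¹ * ∏ i, foxXi ⟨1, ρ i, A i, a i⟩ (c + t * Complex.I) := by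
    have hline : Continuous fun t : ℝ => (c : ℂ) + t * Complex.I := by fun_prop
    refine ((hline.inv₀ hne).neg).mul (continuous_finsetProd _ fun i _ => ?_)
    have : Continuous (foxXi ⟨1, ρ i, A i, a i⟩) :=
      continuous_iff_continuousAt.2 fun s => (analyticAt_foxXi_of_pos (ha i) (hA i) _ s).continuousAt
    exact this.comp hline
  have hB0 : ∀ i, 0 ≤ B i := fun i => (norm_nonneg _).trans (hB i (c : ℂ) (by simp))
  refine (hcont.locallyIntegrable (μ := volume)).integrable_of_isBigO_cocompact
    (g := fun t : ℝ => (1 + ‖t‖) ^ (-(1 + δ))) ?_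
    ((integrable_one_add_norm (by simpa using hδ)).integrableAtFilter _)
  refine Asymptotics.IsBigO.of_bound
    (2 ^ (1 + δ) * (C * ∏ i ∈ Finset.univ.erase i₀, B i)) ?_
  have hlarge : ∀ᶠ t : ℝ in Filter.cocompact ℝ, max 1 (ρ i₀)⁻¹ ≤ ‖t‖ :=
    (tendsto_norm_cocompact_atTop (E := ℝ)).eventually_ge_atTop _
  filter_upwards [hlarge] with t ht
  rw [Real.norm_eq_abs] at ht
  have ht1 : 1 ≤ |t| := (le_max_left _ _).trans ht
  have ht0 : 0 < |t| := by linarith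
  have h1 : ‖((c : ℂ) + t * Complex.I)⁻¹‖ ≤ |t| ^ (-1 : ℝ) := by
    rw [norm_inv, Real.rpow_neg_one]
    refine inv_anti₀ ht0 ?_
    simpa [him t] using Complex.abs_im_le_norm ((c : ℂ) + t * Complex.I)
  have h2 := hC _ (hre t) (by rw [him]; exact (le_max_right _ _).trans ht)
  rw [him] at h2
  have h3 : ‖∏ i ∈ Finset.univ.erase i₀, foxXi ⟨1, ρ i, A i, a i⟩ (c + t * Complex.I)‖ ≤
      ∏ i ∈ Finset.univ.erase i₀, B i := by
    rw [norm_prod]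
    exact Finset.prod_le_prod (fun i _ => norm_nonneg _) fun i _ => hB i _ (hre t)
  have hP : 0 ≤ ∏ i ∈ Finset.univ.erase i₀, B i := Finset.prod_nonneg fun i _ => hB0 i
  have h4 : |t| ^ (-(1 + δ)) ≤ 2 ^ (1 + δ) * (1 + |t|) ^ (-(1 + δ)) := by
    have h5 : (1 + |t|) ^ (1 + δ) ≤ (2 * |t|) ^ (1 + δ) :=
      Real.rpow_le_rpow (by positivity) (by linarith) (by linarith)
    rw [Real.mul_rpow (by norm_num) ht0.le] at h5
    rw [Real.rpow_neg ht0.le, Real.rpow_neg (by positivity), ← div_eq_mul_inv,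
      le_div_iff₀ (by positivity), inv_mul_le_iff₀ (by positivity)]
    linarith
  have hC0 : 0 ≤ C := by
    by_contra hneg
    have : C * |t| ^ (-δ) < 0 := mul_neg_of_neg_of_pos (not_le.1 hneg) (by positivity)
    linarith [norm_nonneg (foxXi ⟨1, ρ i₀, A i₀, a i₀⟩ (c + t * Complex.I))]
  rw [← Finset.mul_prod_erase _ _ (Finset.mem_univ i₀), norm_mul, norm_mul, norm_neg,
    Real.norm_of_nonneg (by positivity : 0 ≤ (1 + ‖t‖) ^ (-(1 + δ))), Real.norm_eq_abs]
  calc _ ≤ |t| ^ (-1 : ℝ) * ((C * |t| ^ (-δ)) * ∏ i ∈ Finset.univ.erase i₀, B i) := by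
        gcongr
    _ = (C * ∏ i ∈ Finset.univ.erase i₀, B i) * |t| ^ (-(1 + δ)) := by
        rw [neg_add, Real.rpow_add ht0]
        ring
    _ ≤ (C * ∏ i ∈ Finset.univ.erase i₀, B i) * (2 ^ (1 + δ) * (1 + |t|) ^ (-(1 + δ))) := by
        gcongr
    _ = _ := by ring

/-! ### Sums of independent variables -/

/-- A sum of independent variables has no atoms as soon as one summand has none. -/
theorem map_add_singleton_eq_zero {S : Type*} [MeasurableSpace S] {μ : Measure S}
    [IsFiniteMeasure μ] {X Y : S → ℝ} (hX : AEMeasurable X μ) (hY : AEMeasurable Y μ)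
    (hXY : IndepFun X Y μ) (hY0 : ∀ y, μ.map Y {y} = 0) (x : ℝ) : μ.map (X + Y) {x} = 0 := by
  rw [hXY.map_add_eq_map_conv_map₀ hX hY, ← lintegral_indicator_one (measurableSet_singleton x),
    Measure.lintegral_conv (measurable_one.indicator (measurableSet_singleton x))]
  have h : ∀ u v : ℝ, ({x} : Set ℝ).indicator (1 : ℝ → ENNReal) (u + v) =
      ({x - u} : Set ℝ).indicator 1 v := by
    intro u v
    simp only [Set.indicator, Set.mem_singleton_iff, eq_sub_iff_add_eq, add_comm v u, Pi.one_apply]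
  simp only [h, lintegral_indicator_one (measurableSet_singleton _), hY0, lintegral_zero]

theorem map_sum_singleton_eq_zero {S ι : Type*} [MeasurableSpace S] {μ : Measure S}
    [IsFiniteMeasure μ] [Fintype ι] [Nonempty ι] {X : ι → S → ℝ} (hX : ∀ i, AEMeasurable (X i) μ)
    (hindep : iIndepFun X μ) (hX0 : ∀ i y, μ.map (X i) {y} = 0) (x : ℝ) :
    μ.map (∑ i, X i) {x} = 0 := by
  classical
  obtain ⟨i₀⟩ := ‹Nonempty ι›
  rw [← Finset.sum_erase_add _ _ (Finset.mem_univ i₀)]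
  exact map_add_singleton_eq_zero (Finset.aemeasurable_sum _ fun i _ => hX i) (hX i₀)
    (hindep.indepFun_finsetSum_of_notMem₀ hX (Finset.notMem_erase i₀ _)) (hX0 i₀) x

theorem complexMGF_sum_of_iIndepFun {S ι : Type*} [MeasurableSpace S] {μ : Measure S}
    [Fintype ι] {X : ι → S → ℝ} (hX : ∀ i, AEMeasurable (X i) μ) (hindep : iIndepFun X μ) (s : ℂ) :
    complexMGF (∑ i, X i) μ s = ∏ i, complexMGF (X i) μ s := by
  simp only [complexMGF]
  have h := hindep.integral_fun_prod_comp (X := X)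
    (f := fun _ (x : ℝ) => Complex.exp (s * (x : ℂ))) hX fun i => by fun_prop
  rw [← h]
  simp only [← Complex.exp_sum, Finset.sum_apply, Complex.ofReal_sum, Finset.mul_sum]

theorem integrable_exp_mul_sum_of_iIndepFun {S ι : Type*} [MeasurableSpace S] {μ : Measure S}
    [IsProbabilityMeasure μ] [Fintype ι] {X : ι → S → ℝ} (hX : ∀ i, AEMeasurable (X i) μ)
    (hindep : iIndepFun X μ) {t : ℝ} (hint : ∀ i, Integrable (fun ω => Real.exp (t * X i ω)) μ) :
    Integrable (fun ω => Real.exp (t * (∑ i, X i) ω)) μ := by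
  rw [← mgf_pos_iff, hindep.mgf_sum₀ hX]
  exact Finset.prod_pos fun i _ => mgf_pos (hint i)

theorem map_scaledLogRate_gammaMeasure_singleton {A ρ γ : ℝ} (hρ : ρ ≠ 0) (hγ : γ ≠ 0)
    (a r y : ℝ) : (gammaMeasure a r).map (scaledLogRate A ρ γ) {y} = 0 := by
  rw [Measure.map_apply (measurable_scaledLogRate A ρ γ) (measurableSet_singleton y)]
  set e := Real.exp (y / ρ - Real.log A) with he
  -- the fibre has at most three points, because `Real.log` is even with `log 0 = 0`
  have hsub : scaledLogRate A ρ γ ⁻¹' {y} ⊆ {-1 / γ, (e - 1) / γ, (-e - 1) / γ} := by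
    intro x hx
    have hx' : Real.log (1 + γ * x) = y / ρ - Real.log A := by
      have : ρ * (Real.log A + Real.log (1 + γ * x)) = y := hx
      field_simp
      linarith
    simp only [Set.mem_insert_iff, Set.mem_singleton_iff, eq_div_iff hγ]
    by_cases h0 : 1 + γ * x = 0
    · left
      linarith
    · right
      have habs : |1 + γ * x| = e := by rw [he, ← hx', Real.exp_log_eq_abs h0]
      rcases abs_choice (1 + γ * x) with h | h
      · left; linarith
      · right; linarith
  have hfin : ({-1 / γ, (e - 1) / γ, (-e - 1) / γ} : Set ℝ).Finite := by simp
  exact (withDensity_absolutelyContinuous _ _) ((hfin.subset hsub).measure_zero volume)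

/-! ### Contours and kernel for variable-rate HARQ -/

theorem foxXi_vrUpper_reflect (i : Fin 1) :
    foxXi (vrUpper i).reflect = fun s => Complex.Gamma (-s) := by
  ext s
  simp [foxXi, vrUpper, FoxParam.reflect]

theorem not_analyticAt_foxXi_vrUpper_reflect (i : Fin 1) :
    ¬ AnalyticAt ℂ (foxXi (vrUpper i).reflect) 0 := by
  intro h
  rw [foxXi_vrUpper_reflect] at h
  have h1 : ContinuousAt (fun s : ℂ => Complex.Gamma (-s)) (-0) := by
    rw [neg_zero]
    exact h.continuousAt
  refine Complex.not_continuousAt_Gamma_zero ?_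
  simpa [Function.comp_def] using h1.comp (f := fun s : ℂ => -s) continuous_neg.continuousAt

theorem vrLower_castSucc {k : ℕ} (γT : ℝ) (m Ω R : Fin k → ℝ) (l : Fin k) :
    vrLower γT m Ω R l.castSucc = ⟨1, 1 / R l, m l / (γT * Ω l), m l⟩ := by
  simp [vrLower]

theorem vrLower_last {k : ℕ} (γT : ℝ) (m Ω R : Fin k → ℝ) :
    vrLower γT m Ω R (Fin.last k) = ⟨0, 1, 0, 1⟩ := by
  simp [vrLower]

/-- The only singularities are the poles `0, 1, 2, …` of `Γ(-s)`, the other factors being entire;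
so the contours are exactly the lines in the left half-plane. -/
theorem isFoxContour_iff {k : ℕ} {γT : ℝ} (hγT : 0 < γT) {m Ω R : Fin k → ℝ} (hm : ∀ l, 0 < m l)
    (hΩ : ∀ l, 0 < Ω l) (c : ℝ) :
    IsFoxContour k 1 vrUpper (vrLower γT m Ω R) c ↔ c < 0 := by
  constructor
  · intro h
    simpa using h.2 0 (by simp) 0 (not_analyticAt_foxXi_vrUpper_reflect 0)
  · intro hc
    refine ⟨fun j hj s hs => ?_, fun i _ s hs => ?_⟩
    · refine absurd ?_ hs
      rw [show j = (Fin.castLT j hj).castSucc from rfl, vrLower_castSucc]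
      exact analyticAt_foxXi_of_pos (hm _) (div_pos (hm _) (mul_pos hγT (hΩ _))) _ s
    · by_contra hle
      refine hs ?_
      rw [foxXi_vrUpper_reflect]
      have hopen : IsOpen {s : ℂ | s.re < 0} := isOpen_lt Complex.continuous_re continuous_const
      refine DifferentiableOn.analyticAt (s := {s : ℂ | s.re < 0}) (fun z hz => ?_)
        (hopen.mem_nhds (show s.re < 0 by linarith))
      have hz : z.re < 0 := hz
      refine DifferentiableAt.differentiableWithinAt ?_
      refine DifferentiableAt.comp z (Complex.differentiableAt_Gamma _ fun n hn => ?_)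
        differentiable_neg.differentiableAt
      have := congrArg Complex.re hn
      simp only [Complex.neg_re, Complex.natCast_re] at this
      have hn0 : (0 : ℝ) ≤ n := n.cast_nonneg
      linarith

/-- On the left half-plane the two Gamma factors of the kernel combine to `Γ(-s) / Γ(1-s) = -1/s`. -/
theorem foxKernel_vr {k : ℕ} (γT : ℝ) (m Ω R : Fin k → ℝ) {s : ℂ} (hs : s.re < 0) :
    foxKernel k 1 vrUpper (vrLower γT m Ω R) s =
      -s⁻¹ * ∏ l, foxXi ⟨1, 1 / R l, m l / (γT * Ω l), m l⟩ s := by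
  have hs0 : s ≠ 0 := by
    rintro rfl
    simp at hs
  have h1 : ∏ j : Fin (k + 1) with j.val < k, foxXi (vrLower γT m Ω R j) s =
      ∏ l, foxXi ⟨1, 1 / R l, m l / (γT * Ω l), m l⟩ s := by
    rw [Finset.prod_filter, Fin.prod_univ_castSucc]
    simp [vrLower_castSucc]
  have h2 : ∏ j : Fin (k + 1) with k ≤ j.val, foxXi (vrLower γT m Ω R j).reflect s =
      Complex.Gamma (-s + 1) := by
    rw [Finset.prod_filter, Fin.prod_univ_castSucc]
    have : ∀ l : Fin k, ¬ k ≤ l.val := fun l => not_le.2 l.isLt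
    simp only [Fin.val_castSucc, this, if_false, Finset.prod_const_one, Fin.val_last, le_refl,
      if_true, vrLower_last, foxXi, FoxParam.reflect, one_mul]
    push_cast
    rw [Complex.Gamma_one, div_one]
    congr 1
    ring
  have h3 : ∏ i : Fin 1 with i.val < 1, foxXi (vrUpper i).reflect s = Complex.Gamma (-s) := by
    simp [foxXi_vrUpper_reflect]
  have h4 : ∏ i : Fin 1 with 1 ≤ i.val, foxXi (vrUpper i) s = 1 := by
    simp
  have hΓ : Complex.Gamma (-s) ≠ 0 := Complex.Gamma_ne_zero_of_re_pos (by simpa using hs)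
  rw [foxKernel, h1, h2, h3, h4, Complex.Gamma_add_one _ (neg_ne_zero.2 hs0)]
  field_simp

/-! ### The outage probability -/

/-- Adding the constants `(1/R_l) log A_l` on both sides turns outage into an event about the
summands whose moments are the factors of the kernel. -/
theorem vrOutageProb_eq_measureReal_map_Iio {S : Type*} [MeasurableSpace S] {μ : Measure S} {k : ℕ}
    {γT : ℝ} {R A : Fin k → ℝ} {α : Fin k → S → ℝ} (hα : ∀ l, AEMeasurable (α l) μ) :
    vrOutageProb μ γT R α =
      (μ.map (∑ l, fun ω => scaledLogRate (A l) (1 / R l) γT (α l ω))).real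
        (Set.Iio (Real.log 2 + ∑ l, 1 / R l * Real.log (A l))) := by
  have hmeas : AEMeasurable (∑ l, fun ω => scaledLogRate (A l) (1 / R l) γT (α l ω)) μ :=
    Finset.aemeasurable_sum _ fun l _ => (measurable_scaledLogRate _ _ _).comp_aemeasurable (hα l)
  rw [vrOutageProb, map_measureReal_apply_of_aemeasurable hmeas measurableSet_Iio]
  congr 1
  ext ω
  have h2 : 0 < Real.log 2 := Real.log_pos one_lt_two
  have hsum : ∑ l, 1 / R l * Real.logb 2 (1 + γT * α l ω) =
      (∑ l, 1 / R l * Real.log (1 + γT * α l ω)) / Real.log 2 := by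
    rw [Finset.sum_div]
    exact Finset.sum_congr rfl fun l _ => by rw [Real.logb, mul_div_assoc]
  simp only [Set.mem_ofPred_eq, Set.mem_preimage, Set.mem_Iio, Finset.sum_apply, scaledLogRate,
    mul_add, Finset.sum_add_distrib]
  rw [hsum, div_lt_one h2]
  constructor <;> intro h <;> linarith

theorem mainTheorem8 {S : Type*} [MeasurableSpace S] (μ : Measure S) [IsProbabilityMeasure μ]
    (k : ℕ) (hk : 1 ≤ k) (γT : ℝ) (hγT : 0 < γT)
    (m Ω R : Fin k → ℝ) (hm : ∀ l, 0 < m l) (hΩ : ∀ l, 0 < Ω l) (hR : ∀ l, 0 < R l)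
    (α : Fin k → S → ℝ)
    (hlaw : ∀ l, HasLaw (α l) (gammaMeasure (m l) (m l / Ω l)) μ)
    (hindep : iIndepFun α μ) :
    (∃ c : ℝ, IsFoxContour k 1 vrUpper (vrLower γT m Ω R) c) ∧
      ∀ c : ℝ, IsFoxContour k 1 vrUpper (vrLower γT m Ω R) c →
        Complex.VerticalIntegrable (foxKernel k 1 vrUpper (vrLower γT m Ω R)) c ∧
          (vrOutageProb μ γT R α : ℂ) =
            foxY k 1 vrUpper (vrLower γT m Ω R) c
              (2 * ∏ l, (m l / (γT * Ω l)) ^ (1 / R l)) := by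
  refine ⟨⟨-1, (isFoxContour_iff hγT hm hΩ _).2 (by norm_num)⟩, fun c hcontour => ?_⟩
  have hc : c < 0 := (isFoxContour_iff hγT hm hΩ c).1 hcontour
  have : Nonempty (Fin k) := ⟨⟨0, hk⟩⟩
  have hA : ∀ l, 0 < m l / (γT * Ω l) := fun l => div_pos (hm l) (mul_pos hγT (hΩ l))
  have hρ : ∀ l, 0 < 1 / R l := fun l => one_div_pos.2 (hR l)
  have hAeq : ∀ l, m l / (γT * Ω l) = m l / Ω l / γT := fun l => by rw [div_div, mul_comm γT]
  have hr : ∀ l, 0 < m l / Ω l := fun l => div_pos (hm l) (hΩ l)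
  have hvert : Complex.VerticalIntegrable (foxKernel k 1 vrUpper (vrLower γT m Ω R)) c := by
    refine (verticalIntegrable_inv_mul_prod_foxXi hm hA hρ hc.ne).congr
      (Filter.Eventually.of_forall fun t => ?_)
    exact (foxKernel_vr γT m Ω R (by simpa using hc)).symm
  refine ⟨hvert, ?_⟩
  set A : Fin k → ℝ := fun l => m l / (γT * Ω l) with hAdef
  set X : Fin k → S → ℝ := fun l ω => scaledLogRate (A l) (1 / R l) γT (α l ω) with hX
  have hXlaw : ∀ l, HasLaw (X l)
      ((gammaMeasure (m l) (m l / Ω l)).map (scaledLogRate (A l) (1 / R l) γT)) μ := fun l =>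
    HasLaw.fun_comp ⟨(measurable_scaledLogRate _ _ _).aemeasurable, rfl⟩ (hlaw l)
  have hXm : ∀ l, AEMeasurable (X l) μ := fun l => (hXlaw l).aemeasurable
  have hXindep : iIndepFun X μ := hindep.comp₀ (fun l => scaledLogRate (A l) (1 / R l) γT)
    (fun l => (hlaw l).aemeasurable) (fun l => (measurable_scaledLogRate _ _ _).aemeasurable)
  have hSm : AEMeasurable (∑ l, X l) μ := Finset.aemeasurable_sum _ fun l _ => hXm l
  have hXint : ∀ l (t : ℝ), Integrable (fun ω => Real.exp (t * X l ω)) μ := by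
    intro l t
    have h1 := integrable_exp_mul_scaledLogRate (hm l) (hr l) hγT (1 / R l) t
    rw [← hAeq, ← (hlaw l).map_eq] at h1
    exact h1.comp_aemeasurable (hlaw l).aemeasurable
  have hmgf : ∀ l s, foxXi ⟨1, 1 / R l, A l, m l⟩ s = complexMGF (X l) μ s := by
    intro l s
    have h1 := congrFun (foxXi_eq_complexMGF (hm l) (hr l) hγT (1 / R l)) s
    rw [← hAeq] at h1
    rw [hAdef, h1]
    refine ((hlaw l).integral_comp (f := fun x =>
      Complex.exp (s * (scaledLogRate (A l) (1 / R l) γT x : ℝ))) ?_).symm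
    exact (by fun_prop : Measurable _).aestronglyMeasurable
  have hprob : IsProbabilityMeasure (μ.map (∑ l, X l)) := Measure.isProbabilityMeasure_map hSm
  have hz : 2 * ∏ l, A l ^ (1 / R l) = Real.exp (Real.log 2 + ∑ l, 1 / R l * Real.log (A l)) := by
    rw [Real.exp_add, Real.exp_log two_pos, Real.exp_sum]
    congr 1
    exact Finset.prod_congr rfl fun l _ => by rw [Real.rpow_def_of_pos (hA l), mul_comm]
  rw [vrOutageProb_eq_measureReal_map_Iio (A := A) fun l => (hlaw l).aemeasurable, foxY, hz]
  refine (mellinInv_eq_measureReal_Iio hc ?_ ?_ (fun s hs => ?_) hvert).symm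
  · refine (integrable_map_measure (by fun_prop) hSm).2 ?_
    exact integrable_exp_mul_sum_of_iIndepFun hXm hXindep fun l => hXint l c
  · refine map_sum_singleton_eq_zero hXm hXindep (fun l y => ?_) _
    rw [(hXlaw l).map_eq]
    exact map_scaledLogRate_gammaMeasure_singleton (hρ l).ne' hγT.ne' _ _ y
  · rw [foxKernel_vr γT m Ω R (by rw [hs]; exact hc), complexMGF_id_map hSm,
      complexMGF_sum_of_iIndepFun hXm hXindep]
    exact congrArg _ (Finset.prod_congr rfl fun l _ => hmgf l s)
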